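/- Let $\mathcal{H}$ be a complex Hilbert space of arbitrary dimension and let $P$ be a positive bounded linear operator on $\mathcal{H}$. Call a bounded linear operator $T$ on $\mathcal{H}$ absolutely norming if for every nonzero closed linear subspace $\mathcal{M}\subseteq\mathcal{H}$ (including $\mathcal{M}=\mathcal{H}$) there is $x\in\mathcal{M}$ with $\|x\|=1$ and $\|Tx\|=\|T|_{\mathcal{M}}\|$, where $\|T|_{\mathcal{M}}\|=\sup\{\|Ty\|: y\in\mathcal{M},\ \|y\|\le 1\}$. Then $P$ is absolutely norming if and only if there exist a real number $\alpha\ge 0$, a positive compact operator $K$ on $\mathcal{H}$ and a self-adjoint finite-rank operator $F$ on $\mathcal{H}$ such that $P=\alpha I+K+F$. -/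

import Mathlib

/-- A bounded operator is norming (property `𝒩`) if it attains its operator norm at a unit vector. -/
def IsNorming {H K : Type*} [NormedAddCommGroup H] [InnerProductSpace ℂ H]
    [NormedAddCommGroup K] [InnerProductSpace ℂ K] (T : H →L[ℂ] K) : Prop :=
  ∃ x : H, ‖x‖ = 1 ∧ ‖T‖ = ‖T x‖

/-- A bounded operator is absolutely norming (property `𝒜𝒩`) if its restriction to every
nonzero closed subspace (the whole space included) is norming. -/
def IsAbsolutelyNorming {H K : Type*} [NormedAddCommGroup H] [InnerProductSpace ℂ H]
    [NormedAddCommGroup K] [InnerProductSpace ℂ K] (T : H →L[ℂ] K) : Prop :=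
  ∀ M : Submodule ℂ H, IsClosed (M : Set H) → M ≠ ⊥ → IsNorming (T ∘L M.subtypeL)

/-- A bounded operator has finite rank if its range is finite-dimensional. -/
def IsFiniteRank {H K : Type*} [NormedAddCommGroup H] [InnerProductSpace ℂ H]
    [NormedAddCommGroup K] [InnerProductSpace ℂ K] (T : H →L[ℂ] K) : Prop :=
  FiniteDimensional ℂ (LinearMap.range (T : H →ₗ[ℂ] K))

section AbsolutelyNorming

open ContinuousLinearMap Filter Topology InnerProductSpace

/-! Sufficiency: restricted to M, `P` gives T with T†T = α² + compact. Maximizing sequences of T are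
approximate eigenvectors of T†T for ‖T‖², so if ‖T‖ ≠ α compactness extracts a maximizer
(`isNorming_of_adjoint_comp_self_eq`). If ‖T‖ = α and M is infinite-dimensional, a unit vector of M
killed by `F` works, since `K` ≥ 0.

Necessity: a maximizer on a closed invariant subspace is an eigenvector, so Zorn yields an
eigenbasis. By `not_strictMono_norm`, the eigenvalues contain no strictly increasing sequence;
applied to mixtures of eigenvectors, it also forbids two accumulation levels. Hence some α has
finitely many eigenvalues below it, and those above accumulate only at α: the negative part of P - α
is `F`, the positive part is `K`. -/

theorem exists_seq_norm_apply_tendsto {E F : Type*} [NormedAddCommGroup E]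
    [InnerProductSpace ℂ E] [NormedAddCommGroup F] [InnerProductSpace ℂ F] [Nontrivial E]
    (T : E →L[ℂ] F) :
    ∃ u : ℕ → E, (∀ n, ‖u n‖ = 1) ∧ Tendsto (fun n => ‖T (u n)‖) atTop (𝓝 ‖T‖) := by
  have key : ∀ n : ℕ, ∃ x : E, ‖x‖ = 1 ∧ ‖T‖ - 1 / ((n : ℝ) + 1) < ‖T x‖ := by
    intro n
    have hn : (0 : ℝ) < 1 / ((n : ℝ) + 1) := by positivity
    by_contra! hcon
    rcases le_or_gt (‖T‖ - 1 / ((n : ℝ) + 1)) 0 with h0 | h0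
    · obtain ⟨x, hx⟩ := exists_norm_eq E (zero_le_one (α := ℝ))
      have hc := hcon x hx
      have : ‖T x‖ = 0 := le_antisymm (hc.trans h0) (norm_nonneg _)
      have h00 : ‖T‖ - 1 / ((n : ℝ) + 1) = 0 := le_antisymm h0 (this ▸ hc)
      have : ‖T‖ ≤ 0 := by
        refine T.opNorm_le_of_unit_norm le_rfl fun y hy => ?_
        exact h00 ▸ hcon y hy
      linarith
    · have := T.opNorm_le_of_unit_norm h0.le hcon
      linarith
  choose u hu1 hu2 using key
  refine ⟨u, hu1, ?_⟩
  refine tendsto_of_tendsto_of_tendsto_of_le_of_le ?_ tendsto_const_nhds (fun n => (hu2 n).le)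
    (fun n => by simpa [hu1 n] using T.le_opNorm (u n))
  simpa using tendsto_const_nhds.sub (tendsto_one_div_add_atTop_nhds_zero_nat (𝕜 := ℝ))

theorem isNorming_of_finiteDimensional {E F : Type*} [NormedAddCommGroup E]
    [InnerProductSpace ℂ E] [NormedAddCommGroup F] [InnerProductSpace ℂ F] [Nontrivial E]
    [FiniteDimensional ℂ E] (T : E →L[ℂ] F) : IsNorming T := by
  have : ProperSpace E := FiniteDimensional.proper ℂ E
  obtain ⟨u, hu, hlim⟩ := exists_seq_norm_apply_tendsto T
  obtain ⟨x, hx, φ, hφ, hux⟩ := (isCompact_sphere (0 : E) 1).tendsto_subseq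
    (x := u) fun n => by simp [hu n]
  exact ⟨x, by simpa using hx, tendsto_nhds_unique (hlim.comp hφ.tendsto_atTop)
    ((T.continuous.norm.tendsto _).comp hux)⟩

/-! ### Maximizing sequences and norm attainment -/

section Maximizing

variable {E F : Type*} [NormedAddCommGroup E] [InnerProductSpace ℂ E] [CompleteSpace E]
  [NormedAddCommGroup F] [InnerProductSpace ℂ F] [CompleteSpace F]

/-- Vectors that almost attain the norm of `T` are almost eigenvectors of `T† T`. -/
theorem norm_adjoint_apply_sub_sq_le (T : E →L[ℂ] F) (x : E) :
    ‖adjoint T (T x) - ((‖T‖ ^ 2 : ℝ) : ℂ) • x‖ ^ 2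
      ≤ ‖T‖ ^ 2 * (‖T‖ ^ 2 * ‖x‖ ^ 2 - ‖T x‖ ^ 2) := by
  have h1 : ‖adjoint T (T x)‖ ≤ ‖T‖ * ‖T x‖ := by
    simpa using (adjoint T).le_opNorm (T x)
  have h2 : ‖adjoint T (T x)‖ ^ 2 ≤ ‖T‖ ^ 2 * ‖T x‖ ^ 2 := by
    rw [← mul_pow]; gcongr
  have h3 : RCLike.re (inner ℂ (adjoint T (T x)) (((‖T‖ ^ 2 : ℝ) : ℂ) • x))
      = ‖T‖ ^ 2 * ‖T x‖ ^ 2 := by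
    rw [inner_smul_right, adjoint_inner_left, inner_self_eq_norm_sq_to_K]
    simp [← Complex.ofReal_pow]
  have h4 : ‖((‖T‖ ^ 2 : ℝ) : ℂ) • x‖ = ‖T‖ ^ 2 * ‖x‖ := by
    rw [norm_smul, Complex.norm_real, Real.norm_of_nonneg (by positivity)]
  rw [@norm_sub_sq ℂ, h3, h4]
  nlinarith

theorem adjoint_apply_of_norm_attained (T : E →L[ℂ] F) {x : E} (hx : ‖x‖ = 1)
    (h : ‖T‖ = ‖T x‖) : adjoint T (T x) = ((‖T‖ ^ 2 : ℝ) : ℂ) • x := by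
  have := norm_adjoint_apply_sub_sq_le T x
  rw [hx, ← h, one_pow, mul_one, sub_self, mul_zero] at this
  exact sub_eq_zero.mp (norm_eq_zero.mp (pow_eq_zero_iff two_ne_zero |>.mp
    (le_antisymm this (sq_nonneg _))))

/-- If `T† T` is a compact perturbation of a scalar different from `‖T‖ ^ 2`, then `T` attains
its norm. -/
theorem isNorming_of_adjoint_comp_self_eq [Nontrivial E] (T : E →L[ℂ] F) (c : ℝ)
    (D : E →L[ℂ] E) (hD : IsCompactOperator D)
    (hT : ∀ x, adjoint T (T x) = (c : ℂ) • x + D x) (hc : ‖T‖ ^ 2 ≠ c) : IsNorming T := by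
  obtain ⟨u, hu, hlim⟩ := exists_seq_norm_apply_tendsto T
  have hz : Tendsto (fun n => D (u n) - ((‖T‖ ^ 2 - c : ℝ) : ℂ) • u n) atTop (𝓝 0) := by
    have h1 : Tendsto (fun n => ‖T‖ ^ 2 * (‖T‖ ^ 2 - ‖T (u n)‖ ^ 2)) atTop (𝓝 0) := by
      have := ((tendsto_const_nhds (x := ‖T‖ ^ 2)).sub (hlim.pow 2)).const_mul (‖T‖ ^ 2)
      rwa [sub_self, mul_zero] at this
    have h2 : Tendsto (fun n => ‖D (u n) - ((‖T‖ ^ 2 - c : ℝ) : ℂ) • u n‖ ^ 2) atTop (𝓝 0) := by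
      refine squeeze_zero (fun n => sq_nonneg _) (fun n => ?_) h1
      have := norm_adjoint_apply_sub_sq_le T (u n)
      rw [hu n, one_pow, mul_one, hT] at this
      convert this using 3
      push_cast
      module
    rw [tendsto_zero_iff_norm_tendsto_zero]
    simpa using h2.sqrt
  obtain ⟨S, hS, hsub⟩ := hD.image_closedBall_subset_compact 1
  obtain ⟨y, -, φ, hφ, hy⟩ := hS.tendsto_subseq
    (x := fun n => D (u n)) fun n => hsub ⟨u n, by simp [hu n], rfl⟩
  have hne : ((‖T‖ ^ 2 - c : ℝ) : ℂ) ≠ 0 := by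
    exact_mod_cast sub_ne_zero.mpr hc
  -- D u and (‖T‖² - c) u are asymptotically equal, so convergence of the former passes to u after
  -- division by the nonzero scalar.
  have hx : Tendsto (fun n => u (φ n)) atTop (𝓝 (((‖T‖ ^ 2 - c : ℝ) : ℂ)⁻¹ • y)) := by
    have := (hy.sub (hz.comp hφ.tendsto_atTop)).const_smul (((‖T‖ ^ 2 - c : ℝ) : ℂ)⁻¹)
    rw [sub_zero] at this
    refine this.congr fun n => ?_
    simp only [Function.comp, sub_sub_cancel]
    rw [smul_smul, inv_mul_cancel₀ hne, one_smul]
  refine ⟨_, tendsto_nhds_unique hx.norm (by simp [hu]), ?_⟩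
  exact tendsto_nhds_unique (hlim.comp hφ.tendsto_atTop)
    ((T.continuous.norm.tendsto _).comp hx)

end Maximizing

/-! ### Finite-rank operators -/

section FiniteRank

variable {E F : Type*} [NormedAddCommGroup E] [InnerProductSpace ℂ E]
  [NormedAddCommGroup F] [InnerProductSpace ℂ F]

theorem IsFiniteRank.isCompactOperator {T : E →L[ℂ] F} (hT : IsFiniteRank T) :
    IsCompactOperator T := by
  have : FiniteDimensional ℂ (LinearMap.range (T : E →ₗ[ℂ] F)) := hT
  have : ProperSpace (LinearMap.range (T : E →ₗ[ℂ] F)) := FiniteDimensional.proper ℂ _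
  exact (isCompactOperator_of_locallyCompactSpace_dom
    (T.codRestrict (LinearMap.range (T : E →ₗ[ℂ] F)) fun x => ⟨x, rfl⟩)).clm_comp
      (Submodule.subtypeL _)

theorem IsFiniteRank.exists_unit_vector_apply_eq_zero {T : E →L[ℂ] F} (hT : IsFiniteRank T)
    (M : Submodule ℂ E) (hM : ¬ FiniteDimensional ℂ M) : ∃ x ∈ M, ‖x‖ = 1 ∧ T x = 0 := by
  have : FiniteDimensional ℂ (LinearMap.range (T : E →ₗ[ℂ] F)) := hT
  let f : M →ₗ[ℂ] LinearMap.range (T : E →ₗ[ℂ] F) := (T : E →ₗ[ℂ] F).rangeRestrict ∘ₗ M.subtype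
  have hf : ¬ Function.Injective f := fun h => hM (FiniteDimensional.of_injective f h)
  rw [← LinearMap.ker_eq_bot, Submodule.eq_bot_iff] at hf
  push Not at hf
  obtain ⟨x, hx, hx0⟩ := hf
  have hx1 : (x : E) ≠ 0 := by simpa using hx0
  have hTx : T (x : E) = 0 := congrArg Subtype.val (LinearMap.mem_ker.mp hx)
  exact ⟨((‖(x : E)‖⁻¹ : ℝ) : ℂ) • (x : E), M.smul_mem _ x.2, by
    rw [norm_smul, Complex.norm_real, norm_inv, norm_norm,
      inv_mul_cancel₀ (norm_ne_zero_iff.mpr hx1)],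
    by rw [map_smul, hTx, smul_zero]⟩

end FiniteRank

/-! ### Sufficiency of the decomposition -/

variable {H : Type*} [NormedAddCommGroup H] [InnerProductSpace ℂ H]

theorem isAbsolutelyNorming_of_eq_add_add [CompleteSpace H] {α : ℝ} (hα : 0 ≤ α)
    {K F : H →L[ℂ] H} (hK : K.IsPositive) (hKc : IsCompactOperator K) (hF : IsSelfAdjoint F)
    (hFr : IsFiniteRank F) :
    IsAbsolutelyNorming ((α : ℂ) • ContinuousLinearMap.id ℂ H + K + F) := by
  intro M hM hM0
  have : CompleteSpace M := hM.completeSpace_coe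
  have : Nontrivial M := Submodule.nontrivial_iff_ne_bot.mpr hM0
  by_cases hfin : FiniteDimensional ℂ M
  · exact isNorming_of_finiteDimensional _
  set P : H →L[ℂ] H := (α : ℂ) • ContinuousLinearMap.id ℂ H + K + F with hPdef
  set T := P ∘L M.subtypeL with hTdef
  -- In the critical case ‖T‖ = α, on ker F the operator is α + K, which does not shrink vectors
  -- below the factor α.
  by_cases hc : ‖T‖ ^ 2 = α ^ 2
  · obtain ⟨x, hxM, hx1, hx0⟩ := hFr.exists_unit_vector_apply_eq_zero M hfin
    refine ⟨⟨x, hxM⟩, hx1, ?_⟩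
    have hle : ‖T ⟨x, hxM⟩‖ ≤ ‖T‖ := by
      simpa [hx1] using T.le_opNorm ⟨x, hxM⟩
    refine le_antisymm ?_ hle
    have hTx : T ⟨x, hxM⟩ = (α : ℂ) • x + K x := by
      simp [hTdef, hPdef, hx0]
    have hsq : α ^ 2 ≤ ‖T ⟨x, hxM⟩‖ ^ 2 := by
      rw [hTx, @norm_add_sq ℂ, inner_smul_left, norm_smul, Complex.norm_real, hx1,
        Real.norm_of_nonneg hα, Complex.conj_ofReal]
      have h1 := hK.re_inner_nonneg_right x
      have h2 : RCLike.re ((α : ℂ) * inner ℂ x (K x)) = α * RCLike.re (inner ℂ x (K x)) := by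
        simp
      rw [h2]
      nlinarith [mul_nonneg hα h1, sq_nonneg ‖K x‖]
    exact (sq_le_sq₀ (norm_nonneg _) (norm_nonneg _)).mp (hc ▸ hsq)
  · set C := K + F
    have hCc : IsCompactOperator C := hKc.add hFr.isCompactOperator
    have hCa : adjoint C = C := (hK.isSelfAdjoint.add hF).adjoint_eq
    refine isNorming_of_adjoint_comp_self_eq T (α ^ 2)
      ((adjoint M.subtypeL) ∘L ((2 * α : ℂ) • C + C ∘L C) ∘L M.subtypeL) ?_ ?_ hc
    · have : IsCompactOperator ((2 * α : ℂ) • C + C ∘L C : H →L[ℂ] H) :=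
        (hCc.smul _).add (hCc.comp_clm C)
      exact (this.comp_clm M.subtypeL).clm_comp (adjoint M.subtypeL)
    · intro x
      have hVV : adjoint M.subtypeL (x : H) = x := by
        refine ext_inner_right ℂ fun y => ?_
        rw [adjoint_inner_left]; rfl
      have hPC : P = (α : ℂ) • ContinuousLinearMap.id ℂ H + C := by
        rw [hPdef, add_assoc]
      have hPa : adjoint P = P := by
        rw [hPC, map_add, hCa, map_smulₛₗ, Complex.conj_ofReal, adjoint_id]
      rw [hTdef, adjoint_comp, hPa]
      simp only [coe_comp, Function.comp_apply, hPC, add_apply, smul_apply, coe_id', id_eq, map_add,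
        map_smul, Submodule.subtypeL_apply, hVV]
      push_cast
      module

/-! ### Maximizers on subspaces and the main obstruction -/

theorem IsAbsolutelyNorming.exists_mem_norm_attained {E F : Type*} [NormedAddCommGroup E]
    [InnerProductSpace ℂ E] [CompleteSpace E] [NormedAddCommGroup F] [InnerProductSpace ℂ F]
    [CompleteSpace F] {T : E →L[ℂ] F} (hT : IsAbsolutelyNorming T) {M : Submodule ℂ E}
    (hM : IsClosed (M : Set E)) (hM0 : M ≠ ⊥) :
    ∃ x ∈ M, ‖x‖ = 1 ∧ (∀ y ∈ M, ‖T y‖ ≤ ‖T x‖ * ‖y‖) ∧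
      ∀ y ∈ M, inner ℂ (T y) (T x) = ((‖T x‖ ^ 2 : ℝ) : ℂ) * inner ℂ y x := by
  have : CompleteSpace M := hM.completeSpace_coe
  obtain ⟨x, hx, hTx⟩ := hT M hM hM0
  have hTx' : ‖T ∘L M.subtypeL‖ = ‖T (x : E)‖ := hTx
  refine ⟨x, x.2, hx, fun y hy => ?_, fun y hy => ?_⟩
  · rw [← hTx']
    exact (T ∘L M.subtypeL).le_opNorm ⟨y, hy⟩
  · have := congrArg (inner ℂ (⟨y, hy⟩ : M)) (adjoint_apply_of_norm_attained _ hx hTx)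
    rw [adjoint_inner_right, inner_smul_right, hTx'] at this
    exact this

/-- An absolutely norming operator has no orthonormal sequence with pairwise orthogonal images
of strictly increasing norm. -/
theorem IsAbsolutelyNorming.not_strictMono_norm {E F : Type*} [NormedAddCommGroup E]
    [InnerProductSpace ℂ E] [CompleteSpace E] [NormedAddCommGroup F] [InnerProductSpace ℂ F]
    [CompleteSpace F] {T : E →L[ℂ] F} (hT : IsAbsolutelyNorming T) {g : ℕ → E}
    (hg : Orthonormal ℂ g) (hTg : Pairwise fun m n => inner ℂ (T (g m)) (T (g n)) = 0) :
    ¬ StrictMono fun n => ‖T (g n)‖ := by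
  intro hmono
  set M := (Submodule.span ℂ (Set.range g)).topologicalClosure with hMdef
  have hgM : ∀ n, g n ∈ M := fun n =>
    Submodule.le_topologicalClosure _ (Submodule.subset_span ⟨n, rfl⟩)
  have hM0 : M ≠ ⊥ := fun h => hg.ne_zero 0 (by simpa [h] using hgM 0)
  obtain ⟨x, hxM, hx1, hle, hinner⟩ :=
    hT.exists_mem_norm_attained (Submodule.isClosed_topologicalClosure _) hM0
  have hlt : ∀ n, ‖T (g n)‖ < ‖T x‖ := fun n =>
    (hmono n.lt_succ_self).trans_le (by simpa [hg.1] using hle _ (hgM (n + 1)))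
  -- The compression of T†T to M is diagonal in `g`; the identity extends from the span by
  -- continuity.
  have hgx : ∀ n, ∀ y ∈ M,
      inner ℂ (T (g n)) (T y) = ((‖T (g n)‖ ^ 2 : ℝ) : ℂ) * inner ℂ (g n) y := by
    intro n
    have hcl : IsClosed {y : E | inner ℂ (T (g n)) (T y)
        = ((‖T (g n)‖ ^ 2 : ℝ) : ℂ) * inner ℂ (g n) y} :=
      isClosed_eq (by fun_prop) (by fun_prop)
    refine fun y hy => closure_minimal (fun z hz => ?_) hcl hy
    change inner ℂ (T (g n)) (T z) = ((‖T (g n)‖ ^ 2 : ℝ) : ℂ) * inner ℂ (g n) z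
    induction hz using Submodule.span_induction with
    | mem z hz =>
      obtain ⟨m, rfl⟩ := hz
      by_cases hnm : n = m
      · subst hnm
        simp [inner_self_eq_norm_sq_to_K, hg.1]
      · rw [hTg hnm, hg.2 hnm, mul_zero]
    | zero => simp
    | add u v _ _ hu hv => rw [map_add, inner_add_right, inner_add_right, hu, hv, mul_add]
    | smul a u _ hu => rw [map_smul, inner_smul_right, inner_smul_right, hu, mul_left_comm]
  -- The maximizer and `g n` belong to different eigenvalues of that compression, hence are
  -- orthogonal; so x is orthogonal to all of M, itself included.
  have hzero : ∀ n, inner ℂ (g n) x = 0 := by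
    intro n
    have h := (hinner _ (hgM n)).symm.trans (hgx n x hxM)
    by_contra h0
    have h1 : ‖T x‖ ^ 2 = ‖T (g n)‖ ^ 2 := by exact_mod_cast mul_right_cancel₀ h0 h
    have h2 := hlt n
    nlinarith [norm_nonneg (T (g n)), norm_nonneg (T x)]
  have hxo : x ∈ (Submodule.span ℂ (Set.range g))ᗮ := by
    rw [Submodule.mem_orthogonal]
    intro u hu
    induction hu using Submodule.span_induction with
    | mem z hz => obtain ⟨m, rfl⟩ := hz; exact hzero m
    | zero => simp
    | add u v _ _ hu hv => rw [inner_add_left, hu, hv, add_zero]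
    | smul a u _ hu => rw [inner_smul_left, hu, mul_zero]
  rw [← Submodule.orthogonal_closure] at hxo
  have : x = 0 := inner_self_eq_zero.mp (Submodule.mem_orthogonal _ _ |>.mp hxo x hxM)
  simp [this] at hx1

/-! ### Orthonormal basis of eigenvectors -/

/-- Since (P + m)(P - m)x = 0, a nonzero (P - m)x would be an eigenvector for -m < 0. -/
theorem ContinuousLinearMap.IsPositive.apply_eq_smul_of_apply_apply_eq {P : H →L[ℂ] H}
    (hP : P.IsPositive) {x : H} {m : ℝ} (hm : 0 < m) (h : P (P x) = ((m ^ 2 : ℝ) : ℂ) • x) :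
    P x = (m : ℂ) • x := by
  set y := P x - (m : ℂ) • x with hy
  have hPy : P y = -((m : ℂ) • y) := by
    rw [hy, map_sub, map_smul, h]
    push_cast
    module
  have h1 := hP.re_inner_nonneg_right y
  rw [hPy, inner_neg_right, inner_smul_right, inner_self_eq_norm_sq_to_K] at h1
  have h2 : RCLike.re (-((m : ℂ) * ((‖y‖ : ℂ)) ^ 2)) = -(m * ‖y‖ ^ 2) := by
    simp [← Complex.ofReal_pow]
  have h3 : 0 ≤ -(m * ‖y‖ ^ 2) := h2 ▸ h1
  have h4 : ‖y‖ ^ 2 = 0 := le_antisymm (by nlinarith) (sq_nonneg _)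
  exact sub_eq_zero.mp (norm_eq_zero.mp (pow_eq_zero_iff two_ne_zero |>.mp h4))

/-- Invariance puts the residual P²x - ‖Px‖²x of a maximizer x inside M, where it can be tested
against itself. -/
theorem IsAbsolutelyNorming.exists_eigenvector_mem [CompleteSpace H] {P : H →L[ℂ] H}
    (hAN : IsAbsolutelyNorming P) (hP : P.IsPositive) {M : Submodule ℂ H}
    (hM : IsClosed (M : Set H)) (hM0 : M ≠ ⊥) (hinv : ∀ x ∈ M, P x ∈ M) :
    ∃ x ∈ M, ‖x‖ = 1 ∧ ∃ m : ℝ, P x = (m : ℂ) • x := by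
  obtain ⟨x, hxM, hx1, -, hinner⟩ := hAN.exists_mem_norm_attained hM hM0
  refine ⟨x, hxM, hx1, ‖P x‖, ?_⟩
  rcases (norm_nonneg (P x)).eq_or_lt with h0 | h0
  · rw [← h0, norm_eq_zero.mp h0.symm]; simp
  refine hP.apply_eq_smul_of_apply_apply_eq h0 (sub_eq_zero.mp ?_)
  set z := P (P x) - ((‖P x‖ ^ 2 : ℝ) : ℂ) • x with hz
  have hzM : z ∈ M := M.sub_mem (hinv _ (hinv _ hxM)) (M.smul_mem _ hxM)
  refine inner_self_eq_zero (𝕜 := ℂ).mp ?_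
  nth_rewrite 2 [hz]
  rw [inner_sub_right, ← hP.inner_left_eq_inner_right, hinner z hzM, inner_smul_right, sub_self]

theorem IsAbsolutelyNorming.exists_hilbertBasis_eigenvectors [CompleteSpace H] {P : H →L[ℂ] H}
    (hAN : IsAbsolutelyNorming P) (hP : P.IsPositive) :
    ∃ (ι : Set H) (b : HilbertBasis ι ℂ H) (l : ι → ℝ), ∀ i, P (b i) = (l i : ℂ) • b i := by
  obtain ⟨s, hs⟩ := zorn_subset
    {s : Set H | Orthonormal ℂ (Subtype.val : s → H) ∧ ∀ x ∈ s, ∃ m : ℝ, P x = (m : ℂ) • x} (by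
      refine fun c hc cc => ⟨⋃₀ c, ⟨?_, ?_⟩, fun _ => Set.subset_sUnion_of_mem⟩
      · exact orthonormal_sUnion_of_directed cc.directedOn fun x xc => (hc xc).1
      · rintro x ⟨t, ht, hxt⟩
        exact (hc ht).2 x hxt)
  obtain ⟨hso, hse⟩ := hs.prop
  -- The complement of the eigenvectors is invariant by symmetry of `P`, so if nonzero it would
  -- enlarge the maximal family.
  have hbot : (Submodule.span ℂ (Set.range (Subtype.val : s → H)))ᗮ = ⊥ := by
    by_contra hne
    obtain ⟨x, hxM, hx1, hxm⟩ := hAN.exists_eigenvector_mem hP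
      (Submodule.isClosed_orthogonal _) hne (by
        intro x hx
        rw [Submodule.mem_orthogonal] at hx ⊢
        intro u hu
        rw [← hP.inner_left_eq_inner_right]
        refine hx _ ?_
        induction hu using Submodule.span_induction with
        | mem z hz =>
          obtain ⟨i, rfl⟩ := hz
          obtain ⟨m, hm⟩ := hse i i.2
          rw [hm]
          exact Submodule.smul_mem _ _ (Submodule.subset_span ⟨i, rfl⟩)
        | zero => simp
        | add u v _ _ hu hv => rw [map_add]; exact Submodule.add_mem _ hu hv
        | smul a u _ hu => rw [map_smul]; exact Submodule.smul_mem _ _ hu)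
    have hsx : ∀ y ∈ s, inner ℂ y x = 0 := fun y hy =>
      (Submodule.mem_orthogonal _ _).mp hxM y (Submodule.subset_span ⟨⟨y, hy⟩, rfl⟩)
    have hins : insert x s ∈ {s : Set H | Orthonormal ℂ (Subtype.val : s → H) ∧
        ∀ x ∈ s, ∃ m : ℝ, P x = (m : ℂ) • x} := by
      refine ⟨⟨?_, ?_⟩, ?_⟩
      · rintro ⟨y, rfl | hy⟩
        · exact hx1
        · exact hso.1 ⟨y, hy⟩
      · rintro ⟨y, rfl | hy⟩ ⟨z, rfl | hz⟩ hyz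
        · exact absurd rfl hyz
        · exact inner_eq_zero_symm.mp (hsx z hz)
        · exact hsx y hy
        · exact hso.2 (i := ⟨y, hy⟩) (j := ⟨z, hz⟩) fun h => hyz (Subtype.ext (Subtype.mk.inj h))
      · rintro y (rfl | hy)
        · exact hxm
        · exact hse y hy
    have hxs : x ∈ s := hs.le_of_ge hins (Set.subset_insert x s) (Set.mem_insert x s)
    have : x = 0 := inner_self_eq_zero.mp (hsx x hxs)
    simp [this] at hx1
  choose l hl using fun i : s => hse i i.2
  exact ⟨s, HilbertBasis.mkOfOrthogonalEqBot hso hbot, l, by simpa using hl⟩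

/-! ### Distribution of the eigenvalues -/

section Diagonal

variable {ι : Type*} {P : H →L[ℂ] H} {b : HilbertBasis ι ℂ H} {l : ι → ℝ}

theorem inner_apply_apply_of_eigenvectors (hb : ∀ i, P (b i) = (l i : ℂ) • b i) (i j : ι) :
    inner ℂ (P (b i)) (P (b j)) = (l i : ℂ) * (l j : ℂ) * inner ℂ (b i) (b j) := by
  rw [hb, hb, inner_smul_left, inner_smul_right, Complex.conj_ofReal, mul_assoc]

theorem IsAbsolutelyNorming.not_strictMono_eigenvalues [CompleteSpace H]
    (hAN : IsAbsolutelyNorming P) (hb : ∀ i, P (b i) = (l i : ℂ) • b i) (hl : ∀ i, 0 ≤ l i)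
    (u : ℕ → ι) : ¬ StrictMono fun n => l (u n) := by
  intro hmono
  have hu : Function.Injective u := fun m n h => hmono.injective (congrArg l h)
  have ho := b.orthonormal.comp u hu
  refine hAN.not_strictMono_norm ho (fun m n hmn => ?_) ?_
  · simp only [Function.comp, inner_apply_apply_of_eigenvectors hb]
    rw [show inner ℂ (b (u m)) (b (u n)) = 0 from ho.2 hmn, mul_zero]
  · convert hmono using 2 with n
    simp [hb, norm_smul, b.orthonormal.1, abs_of_nonneg (hl _)]

/-- The eigenvalues of an absolutely norming operator accumulate at no more than one point. -/
theorem IsAbsolutelyNorming.finite_or_finite [CompleteSpace H]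
    (hAN : IsAbsolutelyNorming P) (hb : ∀ i, P (b i) = (l i : ℂ) • b i) (hl : ∀ i, 0 ≤ l i)
    {c d : ℝ} (hcd : c < d) : {i | l i ≤ c}.Finite ∨ {i | d ≤ l i}.Finite := by
  by_contra! hcon
  obtain ⟨h1, h2⟩ := hcon
  let e : ℕ → ι := fun n => (h1.natEmbedding _ n : ι)
  let f : ℕ → ι := fun n => (h2.natEmbedding _ n : ι)
  have he : ∀ n, l (e n) ≤ c := fun n => (h1.natEmbedding _ n).2
  have hf : ∀ n, d ≤ l (f n) := fun n => (h2.natEmbedding _ n).2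
  have hei : Function.Injective e := Subtype.val_injective.comp (h1.natEmbedding _).injective
  have hfi : Function.Injective f := Subtype.val_injective.comp (h2.natEmbedding _).injective
  have hef : ∀ m n, e m ≠ f n := fun m n h => by
    have := he m; have := hf n; rw [h] at *; linarith
  have hc0 : 0 ≤ c := (hl _).trans (he 0)
  have hoo := fun {i j : ι} (h : i ≠ j) => b.orthonormal.2 h
  obtain ⟨r, hr, hrI, -⟩ := exists_seq_strictMono_tendsto' hcd
  -- The weight is solved from ‖P (g n)‖ = r n, where `g n` mixes an eigenvector from each level and
  -- `r` increases strictly inside (c, d).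
  let t : ℕ → ℝ := fun n => (r n ^ 2 - l (e n) ^ 2) / (l (f n) ^ 2 - l (e n) ^ 2)
  have hpos : ∀ n, 0 < l (f n) ^ 2 - l (e n) ^ 2 := fun n => by
    nlinarith [he n, hf n, hl (e n)]
  have ht0 : ∀ n, 0 ≤ t n := fun n => div_nonneg
    (by nlinarith [he n, (hrI n).1, hl (e n)]) (hpos n).le
  have ht1 : ∀ n, 0 ≤ 1 - t n := fun n => by
    rw [sub_nonneg, div_le_one (hpos n)]
    nlinarith [hf n, (hrI n).1, (hrI n).2]
  have htr : ∀ n, (1 - t n) * l (e n) ^ 2 + t n * l (f n) ^ 2 = r n ^ 2 := fun n => by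
    have : t n * (l (f n) ^ 2 - l (e n) ^ 2) = r n ^ 2 - l (e n) ^ 2 :=
      div_mul_cancel₀ _ (hpos n).ne'
    linarith
  let g : ℕ → H := fun n => (√(1 - t n) : ℂ) • b (e n) + (√(t n) : ℂ) • b (f n)
  have hPg : ∀ n, P (g n)
      = ((√(1 - t n) * l (e n) : ℝ) : ℂ) • b (e n) + ((√(t n) * l (f n) : ℝ) : ℂ) • b (f n) := by
    intro n
    simp only [g, map_add, map_smul, hb, smul_smul, Complex.ofReal_mul]
  have hcross : ∀ {m n : ℕ} (a a' c c' : ℂ), m ≠ n →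
      inner ℂ (a • b (e m) + a' • b (f m)) (c • b (e n) + c' • b (f n)) = 0 := by
    intro m n a a' c c' hmn
    simp [hoo (hei.ne hmn), hoo (hfi.ne hmn), hoo (hef m n), hoo (hef n m).symm]
  have hnorm : ∀ (n : ℕ) (a a' : ℝ), ‖(a : ℂ) • b (e n) + (a' : ℂ) • b (f n)‖ ^ 2
      = a ^ 2 + a' ^ 2 := by
    intro n a a'
    rw [@norm_add_sq ℂ, inner_smul_left, inner_smul_right, hoo (hef n n)]
    simp [norm_smul, b.orthonormal.1]
  have hg1 : ∀ n, ‖g n‖ = 1 := fun n => by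
    have := hnorm n (√(1 - t n)) (√(t n))
    rw [Real.sq_sqrt (ht1 n), Real.sq_sqrt (ht0 n), sub_add_cancel] at this
    exact (pow_eq_one_iff_of_nonneg (norm_nonneg _) two_ne_zero).mp this
  have hPgr : ∀ n, ‖P (g n)‖ = r n := fun n => by
    have := hnorm n (√(1 - t n) * l (e n)) (√(t n) * l (f n))
    rw [← hPg, mul_pow, mul_pow, Real.sq_sqrt (ht1 n), Real.sq_sqrt (ht0 n), htr] at this
    exact (sq_eq_sq₀ (norm_nonneg _) (hc0.trans (hrI n).1.le)).mp this
  refine hAN.not_strictMono_norm (g := g) ⟨hg1, fun m n hmn => hcross _ _ _ _ hmn⟩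
    (fun m n hmn => ?_) (by simpa only [hPgr] using hr)
  simp only [hPg]
  exact hcross _ _ _ _ hmn

/-- The absolutely norming operator `P` has finitely many eigenvalues, with multiplicity, below
some threshold `α`, and those above it accumulate only at `α`. -/
theorem IsAbsolutelyNorming.exists_threshold [CompleteSpace H] [Infinite ι]
    (hAN : IsAbsolutelyNorming P) (hb : ∀ i, P (b i) = (l i : ℂ) • b i) (hl : ∀ i, 0 ≤ l i) :
    ∃ α : ℝ, 0 ≤ α ∧ {i | l i < α}.Finite ∧ ∀ d, α < d → {i | d ≤ l i}.Finite := by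
  -- The threshold is the infimum of the levels with infinitely many eigenvalues at or below them.
  set A := {c : ℝ | {i | l i ≤ c}.Infinite} with hA
  have hlP : ∀ i, l i ≤ ‖P‖ := fun i => by
    simpa [hb, norm_smul, b.orthonormal.1, abs_of_nonneg (hl i)] using P.le_opNorm (b i)
  have hAne : A.Nonempty := ⟨‖P‖, by
    rw [hA, Set.mem_ofPred_eq, Set.eq_univ_of_forall (s := {i | l i ≤ ‖P‖}) hlP]
    exact Set.infinite_univ⟩
  have hA0 : ∀ c ∈ A, 0 ≤ c := fun c hc => by
    obtain ⟨i, hi⟩ := Set.Infinite.nonempty hc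
    exact (hl i).trans hi
  have hbelow : ∀ c < sInf A, {i | l i ≤ c}.Finite := fun c hc => by
    by_contra hinf
    exact notMem_of_lt_csInf hc ⟨0, hA0⟩ hinf
  refine ⟨sInf A, le_csInf hAne hA0, ?_, fun d hd => ?_⟩
  · by_contra hinf
    have hinf' : {i | l i < sInf A}.Infinite := hinf
    have : Nonempty (l '' {i | l i < sInf A}) := (hinf'.nonempty.image l).to_subtype
    -- Only finitely many eigenvalues lie at or below any level under the infimum, so an infinite
    -- set of them has no largest value and contains a strictly increasing sequence.
    have : NoMaxOrder (l '' {i | l i < sInf A}) := by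
      refine ⟨?_⟩
      rintro ⟨_, i, hi, rfl⟩
      obtain ⟨j, hj, hji⟩ := hinf'.exists_notMem_finite (hbelow (l i) hi)
      exact ⟨⟨l j, j, hj, rfl⟩, not_le.mp hji⟩
    obtain ⟨r, hr⟩ := Nat.exists_strictMono (l '' {i | l i < sInf A})
    choose u hu hur using fun n => (r n).2
    exact hAN.not_strictMono_eigenvalues hb hl u fun m n hmn => by
      simp only [hur]
      exact hr hmn
  · obtain ⟨c, hc, hcd⟩ := exists_lt_of_csInf_lt hAne hd
    exact (hAN.finite_or_finite hb hl hcd).resolve_left hc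

/-! ### Diagonal operators and the splitting at the threshold -/

theorem inner_apply_of_isSymmetric (hP : (P : H →ₗ[ℂ] H).IsSymmetric)
    (hb : ∀ i, P (b i) = (l i : ℂ) • b i) (i : ι) (x : H) :
    inner ℂ (b i) (P x) = (l i : ℂ) * inner ℂ (b i) x := by
  have h : inner ℂ (P (b i)) x = inner ℂ (b i) (P x) := hP (b i) x
  rw [← h, hb, inner_smul_left, Complex.conj_ofReal]

theorem HilbertBasis.hasSum_norm_inner_sq (b : HilbertBasis ι ℂ H) (x : H) :
    HasSum (fun i => ‖inner ℂ (b i) x‖ ^ 2) (‖x‖ ^ 2) := by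
  have h := (b.hasSum_inner_mul_inner x x).mapL Complex.reCLM
  rw [inner_self_eq_norm_sq_to_K] at h
  convert h using 1
  · ext i
    rw [← inner_conj_symm x (b i), ← Complex.normSq_eq_conj_mul_self, Complex.normSq_eq_norm_sq]
    exact (Complex.ofReal_re _).symm
  · simp [← Complex.ofReal_pow]

theorem norm_le_of_eigenvalues_le (hP : (P : H →ₗ[ℂ] H).IsSymmetric)
    (hb : ∀ i, P (b i) = (l i : ℂ) • b i) {ε : ℝ} (hε : 0 ≤ ε) (hl : ∀ i, |l i| ≤ ε) :
    ‖P‖ ≤ ε := by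
  refine P.opNorm_le_bound hε fun x => ?_
  have h : ‖P x‖ ^ 2 ≤ ε ^ 2 * ‖x‖ ^ 2 := by
    refine hasSum_le (fun i => ?_) (b.hasSum_norm_inner_sq (P x))
      ((b.hasSum_norm_inner_sq x).mul_left (ε ^ 2))
    rw [inner_apply_of_isSymmetric hP hb, norm_mul, mul_pow, Complex.norm_real, Real.norm_eq_abs]
    gcongr
    exact hl i
  rw [← mul_pow] at h
  exact (sq_le_sq₀ (norm_nonneg _) (by positivity)).mp h

theorem isPositive_of_eigenvalues_nonneg (hP : (P : H →ₗ[ℂ] H).IsSymmetric)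
    (hb : ∀ i, P (b i) = (l i : ℂ) • b i) (hl : ∀ i, 0 ≤ l i) : P.IsPositive := by
  refine isPositive_def.mpr ⟨hP, fun x => ?_⟩
  refine ((b.hasSum_inner_mul_inner (P x) x).mapL Complex.reCLM).nonneg fun i => ?_
  rw [← inner_conj_symm, inner_apply_of_isSymmetric hP hb, map_mul (starRingEnd ℂ),
    Complex.conj_ofReal, mul_assoc, ← Complex.normSq_eq_conj_mul_self, ← Complex.ofReal_mul]
  exact mul_nonneg (hl i) (Complex.normSq_nonneg _)

/-- The finite-rank operator that is diagonal in the basis `b`, with entries `l i` for `i ∈ s`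
and zero elsewhere. -/
noncomputable def finiteDiagonal (b : HilbertBasis ι ℂ H) (l : ι → ℝ) (s : Finset ι) :
    H →L[ℂ] H :=
  ∑ i ∈ s, (l i : ℂ) • rankOne ℂ (b i) (b i)

theorem finiteDiagonal_apply_basis [DecidableEq ι] (s : Finset ι) (j : ι) :
    finiteDiagonal b l s (b j) = ((if j ∈ s then l j else 0 : ℝ) : ℂ) • b j := by
  simp only [finiteDiagonal, sum_apply, smul_apply, rankOne_apply,
    orthonormal_iff_ite.mp b.orthonormal]
  split_ifs with h <;> simp [h]

theorem isSelfAdjoint_finiteDiagonal [CompleteSpace H] (s : Finset ι) :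
    IsSelfAdjoint (finiteDiagonal b l s) := by
  rw [isSelfAdjoint_iff', finiteDiagonal, map_sum]
  refine Finset.sum_congr rfl fun i _ => ?_
  rw [map_smulₛₗ, adjoint_rankOne, Complex.conj_ofReal]

theorem isFiniteRank_finiteDiagonal (s : Finset ι) : IsFiniteRank (finiteDiagonal b l s) := by
  classical
  have hle : LinearMap.range (finiteDiagonal b l s : H →ₗ[ℂ] H)
      ≤ Submodule.span ℂ ((s.image b : Finset H) : Set H) := by
    rintro _ ⟨x, rfl⟩
    simp only [finiteDiagonal, coe_coe, sum_apply, smul_apply, rankOne_apply]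
    exact Submodule.sum_mem _ fun i hi => Submodule.smul_mem _ _ (Submodule.smul_mem _ _
      (Submodule.subset_span (by simpa using ⟨i, hi, rfl⟩)))
  exact Submodule.finiteDimensional_of_le hle

/-- A symmetric diagonal operator whose eigenvalues tend to zero is compact. -/
theorem isCompactOperator_of_eigenvalues [CompleteSpace H] (hP : IsSelfAdjoint P)
    (hb : ∀ i, P (b i) = (l i : ℂ) • b i) (hl : ∀ ε, 0 < ε → {i | ε ≤ |l i|}.Finite) :
    IsCompactOperator P := by
  classical
  have happrox : ∀ ε, 0 < ε → ∃ s : Finset ι, ‖finiteDiagonal b l s - P‖ ≤ ε := by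
    intro ε hε
    -- Keeping exactly the entries of size at least ε leaves a diagonal error with entries below ε.
    refine ⟨(hl ε hε).toFinset, ?_⟩
    refine norm_le_of_eigenvalues_le (b := b)
      (l := fun j => (if j ∈ (hl ε hε).toFinset then l j else 0) - l j)
      ((isSelfAdjoint_finiteDiagonal _).sub hP).isSymmetric (fun j => ?_) hε.le fun j => ?_
    · rw [sub_apply, finiteDiagonal_apply_basis, hb, ← sub_smul, Complex.ofReal_sub]
    · by_cases h : ε ≤ |l j|
      · simpa [h] using hε.le
      · simpa [h] using (not_le.mp h).le
  choose s hs using fun n : ℕ => happrox (1 / ((n : ℝ) + 1)) (by positivity)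
  refine isCompactOperator_of_tendsto (l := atTop) (F := fun n => finiteDiagonal b l (s n)) ?_
    (Eventually.of_forall fun n => (isFiniteRank_finiteDiagonal _).isCompactOperator)
  rw [tendsto_iff_norm_sub_tendsto_zero]
  exact squeeze_zero (fun n => norm_nonneg _) hs tendsto_one_div_add_atTop_nhds_zero_nat

theorem exists_decomposition_of_threshold [CompleteSpace H] (hP : IsSelfAdjoint P)
    (hb : ∀ i, P (b i) = (l i : ℂ) • b i) {α : ℝ} (hfin : {i | l i < α}.Finite)
    (hacc : ∀ d, α < d → {i | d ≤ l i}.Finite) :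
    ∃ K F : H →L[ℂ] H, (K.IsPositive ∧ IsCompactOperator K) ∧
      (IsSelfAdjoint F ∧ IsFiniteRank F) ∧ P = (α : ℂ) • ContinuousLinearMap.id ℂ H + K + F := by
  classical
  set F := finiteDiagonal b (fun i => l i - α) hfin.toFinset with hFdef
  set K := P - (α : ℂ) • ContinuousLinearMap.id ℂ H - F with hKdef
  have hF : IsSelfAdjoint F := isSelfAdjoint_finiteDiagonal _
  have hK : IsSelfAdjoint K := by
    refine (hP.sub ?_).sub hF
    rw [isSelfAdjoint_iff', map_smulₛₗ, Complex.conj_ofReal, adjoint_id]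
  have hKb : ∀ i, K (b i) = ((max (l i - α) 0 : ℝ) : ℂ) • b i := by
    intro i
    rw [hKdef, sub_apply, sub_apply, hb, smul_apply, id_apply, hFdef, finiteDiagonal_apply_basis,
      ← sub_smul, ← sub_smul]
    congr 1
    by_cases h : l i < α
    · simp [h, max_eq_right (sub_nonpos.mpr h.le)]
    · simp [h, max_eq_left (sub_nonneg.mpr (not_lt.mp h))]
  refine ⟨K, F, ⟨isPositive_of_eigenvalues_nonneg hK.isSymmetric hKb fun i => le_max_right _ _,
    isCompactOperator_of_eigenvalues hK hKb fun ε hε => ?_⟩,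
    ⟨hF, isFiniteRank_finiteDiagonal _⟩, by rw [hKdef]; abel⟩
  refine (hacc (α + ε) (by linarith)).subset fun i hi => ?_
  rw [Set.mem_ofPred_eq, abs_of_nonneg (le_max_right _ _), le_max_iff] at hi
  rcases hi with hi | hi
  · rw [Set.mem_ofPred_eq]; linarith
  · linarith

end Diagonal

theorem IsAbsolutelyNorming.exists_decomposition [CompleteSpace H] {P : H →L[ℂ] H}
    (hAN : IsAbsolutelyNorming P) (hP : P.IsPositive) :
    ∃ (α : ℝ) (K F : H →L[ℂ] H), 0 ≤ α ∧ (K.IsPositive ∧ IsCompactOperator K) ∧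
      (IsSelfAdjoint F ∧ IsFiniteRank F) ∧
      P = (α : ℂ) • ContinuousLinearMap.id ℂ H + K + F := by
  obtain ⟨ι, b, l, hb⟩ := hAN.exists_hilbertBasis_eigenvectors hP
  have hl : ∀ i, 0 ≤ l i := fun i => by
    have h := hP.re_inner_nonneg_right (b i)
    rw [hb, inner_smul_right, inner_self_eq_norm_sq_to_K, b.orthonormal.1] at h
    simpa using h
  obtain ⟨α, hα, hfin, hacc⟩ :
      ∃ α : ℝ, 0 ≤ α ∧ {i | l i < α}.Finite ∧ ∀ d, α < d → {i | d ≤ l i}.Finite := by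
    rcases finite_or_infinite ι with _ | _
    -- With a finite basis any threshold would do.
    · exact ⟨0, le_rfl, Set.toFinite _, fun _ _ => Set.toFinite _⟩
    · exact hAN.exists_threshold hb hl
  obtain ⟨K, F, h⟩ := exists_decomposition_of_threshold hP.isSelfAdjoint hb hfin hacc
  exact ⟨α, K, F, hα, h⟩

end AbsolutelyNorming

theorem theorem5p1 {H : Type*} [NormedAddCommGroup H] [InnerProductSpace ℂ H] [CompleteSpace H]
    (P : H →L[ℂ] H) (hP : P.IsPositive) :
    IsAbsolutelyNorming P ↔
      ∃ (α : ℝ) (K F : H →L[ℂ] H), 0 ≤ α ∧ (K.IsPositive ∧ IsCompactOperator K) ∧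
        (IsSelfAdjoint F ∧ IsFiniteRank F) ∧
        P = (α : ℂ) • ContinuousLinearMap.id ℂ H + K + F := by
  refine ⟨fun h => h.exists_decomposition hP, ?_⟩
  rintro ⟨α, K, F, hα, ⟨hK, hKc⟩, ⟨hF, hFr⟩, rfl⟩
  exact isAbsolutelyNorming_of_eq_add_add hα hK hKc hF hFr
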